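/- Let $k$ be a field of characteristic $0$, $n\ge 0$ an integer, and let $A=k[x_{11},\dots,x_{nn},1/\det(x_{ij})]$ be the Hopf algebra of functions of the algebraic group $Gl_n$ over $k$. Its comultiplication is the $k$-algebra morphism $\Delta\colon A\to A\otimes_k A$ with $\Delta(x_{ij})=\sum_l x_{il}\otimes x_{lj}$. An invariant integral on $Gl_n$ is a $k$-linear form $w\colon A\to k$ that is normalized, $w(1)=1$, and invariant under left and right translations, that is, $(w\otimes \mathrm{id})(\Delta a)=w(a)\cdot 1=(\mathrm{id}\otimes w)(\Delta a)$ for all $a\in A$. Let $D=\det(\partial/\partial x_{ij})$ be the Cayley operator on $k[x_{11},\dots,x_{nn}]$. There is exactly one invariant integral $w_{Gl_n}$ on $Gl_n$. For every polynomial $p\in k[x_{11},\dots,x_{nn}]$ and every integer $s\ge 0$, with $p_{ns}$ the homogeneous component of $p$ of degree $ns$, the polynomials $D^s(p_{ns})$ and $D^s(\det^s)$ are constants, $D^s(\det^s)\neq 0$, and $$w_{Gl_n}\!\left(\frac{p}{\det^s}\right)=\frac{D^s(p_{ns})}{D^s(\det^s)} .$$ Moreover $$D^s(\det{}^s)=\mu_s\cdot\mu_{s-1}\cdots\mu_1,\qquad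 \mu_r=\frac{(r+n-1)!}{(r-1)!}\quad (r\ge 1).$$ -/

import Mathlib

open MvPolynomial TensorProduct

noncomputable section

namespace GLIntegral

universe u

/-- The ring of functions `k[x_{11}, …, x_{nn}]` of the variety of `n × n` matrices;
the coordinate `x_{ij}` is the variable `X (i, j)`. -/
abbrev MatCoord (k : Type u) [Field k] (n : ℕ) : Type u :=
  MvPolynomial (Fin n × Fin n) k

/-- The polynomial `det (x_{ij})`. -/
def detX (k : Type u) [Field k] (n : ℕ) : MatCoord k n :=
  (Matrix.mvPolynomialX (Fin n) (Fin n) k).det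

/-- The ring of functions `k[x_{11}, …, x_{nn}, 1 / det (x_{ij})]` of the general linear group. -/
abbrev GLCoord (k : Type u) [Field k] (n : ℕ) : Type u :=
  Localization.Away (detX k n)

/-- The element `p / det ^ s` of the ring of functions of the general linear group. -/
def divDetPow {k : Type u} [Field k] {n : ℕ} (p : MatCoord k n) (s : ℕ) : GLCoord k n :=
  Localization.mk p ⟨detX k n ^ s, s, rfl⟩

section HopfStructure

variable (k : Type u) [Field k] (n : ℕ)

/-- The generic invertible matrix `(x_{ij})`. -/
def genMat : Matrix (Fin n) (Fin n) (GLCoord k n) :=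
  (algebraMap (MatCoord k n) (GLCoord k n)).mapMatrix (Matrix.mvPolynomialX (Fin n) (Fin n) k)

theorem isUnit_det_genMat : IsUnit (genMat k n).det := by
  rw [genMat, ← RingHom.map_det]
  exact IsLocalization.Away.algebraMap_isUnit (detX k n)

variable {k n}

/-- The point of the general linear group with values in a commutative algebra `B` given by an
invertible matrix `M`, i.e. the algebra morphism `x_{ij} ↦ M_{ij}`. -/
def evalGL {B : Type*} [CommRing B] [Algebra k B] (M : Matrix (Fin n) (Fin n) B)
    (hM : IsUnit M.det) : GLCoord k n →ₐ[k] B :=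
  IsLocalization.liftAlgHom (M := Submonoid.powers (detX k n))
    (f := MvPolynomial.aeval fun ij : Fin n × Fin n => M ij.1 ij.2) (by
      rintro ⟨_, s, rfl⟩
      have h : MvPolynomial.aeval (fun ij : Fin n × Fin n => M ij.1 ij.2) (detX k n) = M.det := by
        rw [detX, AlgHom.map_det]
        congr 1
        ext i j
        simp
      simpa [h] using hM.pow s)

theorem map_genMat_evalGL {B : Type*} [CommRing B] [Algebra k B] (M : Matrix (Fin n) (Fin n) B)
    (hM : IsUnit M.det) : (genMat k n).map (evalGL M hM) = M := by
  ext i j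
  simp [genMat, evalGL]

theorem algHom_ext_genMat {B : Type*} [CommRing B] [Algebra k B] {f g : GLCoord k n →ₐ[k] B}
    (h : (genMat k n).map f = (genMat k n).map g) : f = g := by
  apply IsLocalization.algHom_ext (Submonoid.powers (detX k n))
  apply MvPolynomial.algHom_ext
  rintro ⟨i, j⟩
  exact congrFun (congrFun h i) j

theorem isUnit_det_map {A B : Type*} [CommRing A] [CommRing B] [Algebra k A] [Algebra k B]
    (f : A →ₐ[k] B) {M : Matrix (Fin n) (Fin n) A} (hM : IsUnit M.det) :
    IsUnit (M.map f).det := by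
  have h := hM.map f
  rw [AlgHom.map_det] at h
  exact h

theorem map_mul_algHom {A B : Type*} [Semiring A] [Semiring B] [Algebra k A] [Algebra k B]
    (f : A →ₐ[k] B) (M N : Matrix (Fin n) (Fin n) A) : (M * N).map f = M.map f * N.map f :=
  Matrix.map_mul

variable (k n)

/-- The product of the two universal points of the group: the matrix
`(∑ l, x_{il} ⊗ x_{lj})`. -/
def mulMat : Matrix (Fin n) (Fin n) (GLCoord k n ⊗[k] GLCoord k n) :=
  (genMat k n).map (Algebra.TensorProduct.includeLeft :
      GLCoord k n →ₐ[k] GLCoord k n ⊗[k] GLCoord k n) *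
    (genMat k n).map (Algebra.TensorProduct.includeRight :
      GLCoord k n →ₐ[k] GLCoord k n ⊗[k] GLCoord k n)

theorem isUnit_det_mulMat : IsUnit (mulMat k n).det := by
  rw [mulMat, Matrix.det_mul]
  exact (isUnit_det_map _ (isUnit_det_genMat k n)).mul (isUnit_det_map _ (isUnit_det_genMat k n))

/-- Comultiplication, dual to the product of matrices: `x_{ij} ↦ ∑ l, x_{il} ⊗ x_{lj}`. -/
def comulGL : GLCoord k n →ₐ[k] GLCoord k n ⊗[k] GLCoord k n :=
  evalGL (mulMat k n) (isUnit_det_mulMat k n)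

/-- Counit, dual to the identity matrix. -/
def counitGL : GLCoord k n →ₐ[k] k :=
  evalGL 1 (by simp)

/-- Antipode, dual to the inversion of matrices. -/
def antipodeGL : GLCoord k n →ₐ[k] GLCoord k n :=
  evalGL (genMat k n)⁻¹ ((Matrix.isUnit_nonsing_inv_det_iff).2 (isUnit_det_genMat k n))

theorem map_comulGL {B : Type*} [Semiring B] [Algebra k B]
    (f : GLCoord k n ⊗[k] GLCoord k n →ₐ[k] B) :
    (genMat k n).map (f.comp (comulGL k n)) =
      (genMat k n).map (f.comp Algebra.TensorProduct.includeLeft) *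
        (genMat k n).map (f.comp Algebra.TensorProduct.includeRight) := by
  have h : (genMat k n).map (f.comp (comulGL k n)) =
      ((genMat k n).map (comulGL k n)).map f := rfl
  rw [h, comulGL, map_genMat_evalGL, mulMat, map_mul_algHom]
  rfl

theorem map_evalGL_comp {B C : Type*} [CommRing B] [Algebra k B] [CommRing C] [Algebra k C]
    (f : B →ₐ[k] C) (M : Matrix (Fin n) (Fin n) B) (hM : IsUnit M.det) :
    (genMat k n).map (f.comp (evalGL M hM)) = M.map f := by
  have h : (genMat k n).map (f.comp (evalGL M hM)) = ((genMat k n).map (evalGL M hM)).map f := rfl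
  rw [h, map_genMat_evalGL]

theorem comulGL_genMat (i j : Fin n) :
    comulGL k n (genMat k n i j) = ∑ l, genMat k n i l ⊗ₜ[k] genMat k n l j := by
  have h := congrFun (congrFun (map_genMat_evalGL (k := k) (mulMat k n) (isUnit_det_mulMat k n)) i) j
  refine h.trans ?_
  simp [mulMat, Matrix.mul_apply]

theorem coassocGL :
    (Algebra.TensorProduct.assoc k k k (GLCoord k n) (GLCoord k n) (GLCoord k n)).toAlgHom.comp
      ((Algebra.TensorProduct.map (comulGL k n) (.id k (GLCoord k n))).comp (comulGL k n)) =
    (Algebra.TensorProduct.map (.id k (GLCoord k n)) (comulGL k n)).comp (comulGL k n) := by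
  refine algHom_ext_genMat (B := GLCoord k n ⊗[k] (GLCoord k n ⊗[k] GLCoord k n)) ?_
  ext i j
  simp only [Matrix.map_apply, AlgHom.comp_apply, comulGL_genMat, map_sum,
    Algebra.TensorProduct.map_tmul, AlgHom.id_apply, TensorProduct.sum_tmul,
    TensorProduct.tmul_sum]
  rw [Finset.sum_comm]
  rfl

instance instBialgebraGL : Bialgebra k (GLCoord k n) :=
  Bialgebra.ofAlgHom (comulGL k n) (counitGL k n) (coassocGL k n)
    (by
      apply algHom_ext_genMat
      rw [map_comulGL, Algebra.TensorProduct.map_comp_includeLeft,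
        Algebra.TensorProduct.map_comp_includeRight, counitGL, map_evalGL_comp,
        Matrix.map_one _ (_root_.map_zero _) (_root_.map_one _)]
      ext i j
      simp)
    (by
      apply algHom_ext_genMat
      rw [map_comulGL, Algebra.TensorProduct.map_comp_includeLeft,
        Algebra.TensorProduct.map_comp_includeRight, counitGL, map_evalGL_comp,
        Matrix.map_one _ (_root_.map_zero _) (_root_.map_one _)]
      ext i j
      simp)

instance instHopfAlgebraGL : HopfAlgebra k (GLCoord k n) :=
  HopfAlgebra.ofAlgHom (antipodeGL k n)
    (by
      apply algHom_ext_genMat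
      change (genMat k n).map (AlgHom.comp _ (comulGL k n)) =
        (genMat k n).map (AlgHom.comp _ (counitGL k n))
      rw [map_comulGL, counitGL, map_evalGL_comp,
        Matrix.map_one _ (_root_.map_zero _) (_root_.map_one _)]
      have h := Matrix.nonsing_inv_mul (genMat k n) (isUnit_det_genMat k n)
      have h' : (genMat k n).map (antipodeGL k n) = (genMat k n)⁻¹ := map_genMat_evalGL _ _
      rw [← h'] at h
      rw [← h]
      congr 1 <;> ext i j <;> exact (Algebra.TensorProduct.lift_tmul _ _ (fun _ => Commute.all _) _ _).trans
        (by simp))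
    (by
      apply algHom_ext_genMat
      change (genMat k n).map (AlgHom.comp _ (comulGL k n)) =
        (genMat k n).map (AlgHom.comp _ (counitGL k n))
      rw [map_comulGL, counitGL, map_evalGL_comp,
        Matrix.map_one _ (_root_.map_zero _) (_root_.map_one _)]
      have h := Matrix.mul_nonsing_inv (genMat k n) (isUnit_det_genMat k n)
      have h' : (genMat k n).map (antipodeGL k n) = (genMat k n)⁻¹ := map_genMat_evalGL _ _
      rw [← h'] at h
      rw [← h]
      congr 1 <;> ext i j <;> simp)

end HopfStructure

/-- The Cayley operator `D = det (∂/∂x_{ij})`, a differential operator on `k[x_{11}, …, x_{nn}]`;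
the (commuting) partial derivatives are composed in the algebra of linear endomorphisms. -/
def cayleyOp (k : Type u) [Field k] (n : ℕ) : Module.End k (MatCoord k n) :=
  ∑ σ : Equiv.Perm (Fin n), ((Equiv.Perm.sign σ : ℤ) : k) •
    (List.ofFn fun i : Fin n => (pderiv (R := k) (σ i, i)).toLinearMap).prod

/-- A linear form `w` on the ring of functions `A` of an affine `k`-group `G = Spec A` is the
invariant integral on `G` when it is normalized, `w 1 = 1`, and invariant under left and right
translations: for the comultiplication `Δ` of `A`, which represents the translate
of a function by the universal point of `G`, one has `(w ⊗ id) (Δ a) = w a` and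
`(id ⊗ w) (Δ a) = w a` for every function `a`. -/
structure IsInvariantIntegral (k : Type*) {A : Type*} [Field k] [CommRing A] [HopfAlgebra k A]
    (w : A →ₗ[k] k) : Prop where
  map_one : w 1 = 1
  left_inv : ∀ a : A,
    TensorProduct.lid k A (w.rTensor A (Coalgebra.comul (R := k) a)) = algebraMap k A (w a)
  right_inv : ∀ a : A,
    TensorProduct.rid k A (w.lTensor A (Coalgebra.comul (R := k) a)) = algebraMap k A (w a)

/-- `μ_r = (r + n - 1)! / (r - 1)!`, for `r ≥ 1`. -/
def mu (k : Type*) [Field k] (n r : ℕ) : k :=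
  ((r + n - 1).factorial : k) / ((r - 1).factorial : k)

end GLIntegral

end

/-! The Fischer pairing `⟨p, q⟩`, the constant term of `p(∂) q`, makes multiplication by `X a`
adjoint to `∂/∂X a`, hence multiplication by `det` adjoint to the Cayley operator `D`. So the
constant term of `D ^ s p` is `⟨det ^ s, p⟩`, which sees only the component of `p` of degree `ns`.
The integral is therefore defined as `⟨det ^ s, p⟩ / (μ_s ⋯ μ_1)` on `p / det ^ s`.

It is well defined by Cayley's identity `D (det ^ (s + 1)) = μ_{s+1} det ^ s`
(`cayleyOp_detX_pow_succ`): moving one `det` across the pairing produces exactly the new factor of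
the denominator. The identity is proved on the group itself, where `∂_{ij}` acts on `det ^ s` and on
the entries of `x⁻¹` by closed formulas.

It is invariant because the adjoint of a linear substitution is the transposed one
(`fischer_aeval_linear`), and a translation by `g` multiplies `det ^ s` by `det g ^ s`, which
cancels against the translated denominator. Uniqueness is formal: a left invariant and a right
invariant normalized form agree, by Fubini. -/

noncomputable section

namespace GLIntegral

/-! ### The Fischer pairing and its adjunctions. -/

section Fischer

variable {σ R : Type*} [CommRing R]

/-- The product of the factorials of the exponents of a monomial. -/
def multiFactorial (α : σ →₀ ℕ) : ℕ := α.prod fun _ m => m.factorial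

theorem multiFactorial_add_single (α : σ →₀ ℕ) (a : σ) :
    multiFactorial (α + Finsupp.single a 1) = (α a + 1) * multiFactorial α := by
  classical
  have h1 : α + Finsupp.single a 1 = α.erase a + Finsupp.single a (α a + 1) := by
    rw [Finsupp.single_add, ← add_assoc, Finsupp.erase_add_single]
  have hd (m : ℕ) : Disjoint (α.erase a).support (Finsupp.single a m).support := by
    rw [Finset.disjoint_left]
    intro b hb hb'
    have := Finsupp.support_single_subset hb'
    simp_all
  have h2 : multiFactorial α = multiFactorial (α.erase a + Finsupp.single a (α a)) := by
    rw [Finsupp.erase_add_single]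
  rw [h1, h2, multiFactorial, multiFactorial, Finsupp.prod_add_index_of_disjoint (hd _),
    Finsupp.prod_add_index_of_disjoint (hd _), Finsupp.prod_single_index (by simp),
    Finsupp.prod_single_index (by simp), Nat.factorial_succ]
  ring

variable (σ R) in
/-- The Fischer pairing of polynomials: monomials are orthogonal, and
`⟨x ^ α, x ^ α⟩ = α!`. -/
def fischer : MvPolynomial σ R →ₗ[R] MvPolynomial σ R →ₗ[R] R :=
  (basisMonomials σ R).constr R fun α => (multiFactorial α : R) • lcoeff R α

theorem fischer_monomial_left (α : σ →₀ ℕ) (c : R) (q : MvPolynomial σ R) :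
    fischer σ R (monomial α c) q = c * (multiFactorial α * coeff α q) := by
  have h : monomial α c = c • basisMonomials σ R α := by
    simp [coe_basisMonomials, smul_monomial]
  rw [h, map_smul, fischer, Module.Basis.constr_basis]
  simp

theorem fischer_monomial [DecidableEq σ] (α β : σ →₀ ℕ) (c d : R) :
    fischer σ R (monomial α c) (monomial β d) = if β = α then multiFactorial α * (c * d) else 0 := by
  rw [fischer_monomial_left, coeff_monomial]
  split_ifs <;> ring

theorem fischer_one_left (q : MvPolynomial σ R) : fischer σ R 1 q = constantCoeff q := by
  have h := fischer_monomial_left (0 : σ →₀ ℕ) (1 : R) q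
  simpa [multiFactorial, constantCoeff_eq] using h

theorem fischer_symm (p q : MvPolynomial σ R) : fischer σ R p q = fischer σ R q p := by
  classical
  induction p using MvPolynomial.induction_on' with
  | add p₁ p₂ h₁ h₂ => simp only [map_add, LinearMap.add_apply, h₁, h₂]
  | monomial α c =>
    induction q using MvPolynomial.induction_on' with
    | add p₁ p₂ h₁ h₂ => simp only [map_add, LinearMap.add_apply, h₁, h₂]
    | monomial β d =>
      rw [fischer_monomial, fischer_monomial]
      by_cases h : β = α
      · subst h; simp [mul_comm c d]
      · rw [if_neg h, if_neg (Ne.symm h)]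

/-- The factorial weights are chosen for this: raising the exponent of `a` multiplies the weight by
`α a + 1`, the factor that differentiation produces. -/
theorem fischer_X_mul (a : σ) (p q : MvPolynomial σ R) :
    fischer σ R (X a * p) q = fischer σ R p (pderiv a q) := by
  classical
  induction p using MvPolynomial.induction_on' with
  | add p₁ p₂ h₁ h₂ => simp only [mul_add, map_add, LinearMap.add_apply, h₁, h₂]
  | monomial α c =>
    rw [X, monomial_mul, one_mul, add_comm, fischer_monomial_left, fischer_monomial_left,
      coeff_pderiv, multiFactorial_add_single]
    push_cast
    ring

/-- The chain rule for a linear substitution. -/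
theorem pderiv_aeval_linear [Fintype σ] (N : σ → σ → R) (b : σ) (p : MvPolynomial σ R) :
    pderiv b (aeval (fun a => ∑ b, C (N a b) * X b) p) =
      aeval (fun a => ∑ b, C (N a b) * X b) (∑ a, C (N a b) * pderiv a p) := by
  classical
  induction p using MvPolynomial.induction_on with
  | C r => simp [MvPolynomial.algebraMap_eq]
  | add p q hp hq => simp only [map_add, hp, hq, mul_add, Finset.sum_add_distrib]
  | mul_X p i hp =>
    have h1 : pderiv b (∑ b', C (N i b') * X b' : MvPolynomial σ R) = C (N i b) := by
      simp [pderiv_X, Pi.single_apply]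
    have h2 : ∑ a, C (N a b) * pderiv a (p * X i) =
        (∑ a, C (N a b) * pderiv a p) * X i + C (N i b) * p := by
      simp only [pderiv_mul, pderiv_X, Pi.single_apply, mul_add, Finset.sum_add_distrib,
        Finset.sum_mul, mul_assoc]
      congr 1
      simp
    rw [h2, map_mul, pderiv_mul, hp, map_add, map_mul, map_mul, aeval_X, h1, aeval_C,
      MvPolynomial.algebraMap_eq]
    ring

/-- With respect to the Fischer pairing, the adjoint of a linear substitution is the
transposed substitution. -/
theorem fischer_aeval_linear [Fintype σ] (N : σ → σ → R) (p q : MvPolynomial σ R) :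
    fischer σ R p (aeval (fun a => ∑ b, C (N a b) * X b) q) =
      fischer σ R (aeval (fun b => ∑ a, C (N a b) * X a) p) q := by
  induction p using MvPolynomial.induction_on generalizing q with
  | C r =>
    -- A constant pairs only with the constant term, which a linear substitution preserves.
    have h (q : MvPolynomial σ R) : fischer σ R (C r) q = r * constantCoeff q := by
      rw [← fischer_one_left, ← smul_eq_mul, ← LinearMap.smul_apply, ← map_smul, smul_eq_C_mul,
        mul_one]
    rw [aeval_C, MvPolynomial.algebraMap_eq, h, h]
    congr 1
    induction q using MvPolynomial.induction_on with
    | C r => simp [MvPolynomial.algebraMap_eq]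
    | add p q hp hq => simp only [map_add, hp, hq]
    | mul_X p i hp => simp
  | add p₁ p₂ h₁ h₂ => simp only [map_add, LinearMap.add_apply, h₁, h₂]
  | mul_X p b hp =>
    -- `X b` crosses the pairing as `∂_b`, the chain rule turns it into `∑ a, N a b ∂_a`, and each
    -- `∂_a` crosses back as `X a`.
    rw [mul_comm, fischer_X_mul, pderiv_aeval_linear, hp, map_mul, aeval_X, Finset.sum_mul,
      map_sum, map_sum, LinearMap.sum_apply]
    refine Finset.sum_congr rfl fun a _ => ?_
    rw [mul_assoc, ← smul_eq_C_mul, ← smul_eq_C_mul, map_smul, map_smul, LinearMap.smul_apply,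
      fischer_X_mul]

theorem fischer_eq_zero_of_isHomogeneous {m d : ℕ} (hmd : m ≠ d) {p q : MvPolynomial σ R}
    (hp : p.IsHomogeneous m) (hq : q.IsHomogeneous d) : fischer σ R p q = 0 := by
  rw [p.as_sum, map_sum, LinearMap.sum_apply]
  refine Finset.sum_eq_zero fun α hα => ?_
  rw [fischer_monomial_left, hq.coeff_eq_zero, mul_zero, mul_zero]
  rwa [Finsupp.degree_eq_weight_one, ← Pi.one_def, hp (mem_support_iff.1 hα)]

theorem fischer_homogeneousComponent {m : ℕ} {p : MvPolynomial σ R} (hp : p.IsHomogeneous m)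
    (q : MvPolynomial σ R) :
    fischer σ R p (homogeneousComponent m q) = fischer σ R p q := by
  conv_rhs => rw [← sum_homogeneousComponent q, map_sum]
  by_cases hm : m ∈ Finset.range (q.totalDegree + 1)
  · exact (Finset.sum_eq_single_of_mem m hm fun d _ hd =>
      fischer_eq_zero_of_isHomogeneous hd.symm hp (homogeneousComponent_isHomogeneous d q)).symm
  · rw [homogeneousComponent_eq_zero m q (by simpa using hm), map_zero]
    refine (Finset.sum_eq_zero fun d hd => ?_).symm
    exact fischer_eq_zero_of_isHomogeneous (by rintro rfl; exact hm hd) hp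
      (homogeneousComponent_isHomogeneous d q)

/-- Base change, needed because translation by the universal point has coefficients in `GLCoord k
n`. -/
theorem map_fischer {S : Type*} [CommRing S] (f : R →+* S) (p q : MvPolynomial σ R) :
    fischer σ S (map f p) (map f q) = f (fischer σ R p q) := by
  induction p using MvPolynomial.induction_on' with
  | add p₁ p₂ h₁ h₂ => simp only [map_add, LinearMap.add_apply, h₁, h₂]
  | monomial α c => simp [fischer_monomial_left, coeff_map]

end Fischer

/-! ### The Cayley operator as adjoint of the determinant. -/

section CayleyAdjoint

variable {k : Type*} [Field k] {n : ℕ}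

theorem fischer_prod_X_mul {σ R : Type*} [CommRing R] (l : List σ) (p q : MvPolynomial σ R) :
    fischer σ R ((l.map X).prod * p) q =
      fischer σ R p ((l.map fun a => ((pderiv a).toLinearMap : Module.End R _)).prod q) := by
  induction l generalizing p q with
  | nil => simp
  | cons a l ih =>
    rw [List.map_cons, List.prod_cons, mul_comm (X a), mul_assoc, ih, fischer_X_mul,
      List.map_cons, List.prod_cons]
    rfl

/-- The Cayley operator is adjoint to the multiplication by the determinant. -/
theorem fischer_detX_mul (p q : MatCoord k n) :
    fischer _ k (detX k n * p) q = fischer _ k p (cayleyOp k n q) := by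
  rw [detX, Matrix.det_apply, cayleyOp, Finset.sum_mul, map_sum, LinearMap.sum_apply,
    LinearMap.sum_apply, map_sum]
  refine Finset.sum_congr rfl fun σ _ => ?_
  have h := fischer_prod_X_mul (R := k) (List.ofFn fun i : Fin n => (σ i, i)) p q
  rw [List.map_ofFn, List.map_ofFn, List.prod_ofFn] at h
  have h' : (Equiv.Perm.sign σ • ∏ i, Matrix.mvPolynomialX (Fin n) (Fin n) k (σ i) i) * p =
      ((Equiv.Perm.sign σ : ℤ) : k) • ((∏ i, (X (σ i, i) : MatCoord k n)) * p) := by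
    rw [Units.smul_def, smul_mul_assoc, Int.cast_smul_eq_zsmul]
    rfl
  rw [h', map_smul, LinearMap.smul_apply, LinearMap.smul_apply, map_smul]
  congr 1

theorem fischer_detX_pow (p : MatCoord k n) (s : ℕ) :
    fischer _ k (detX k n ^ s) p = constantCoeff ((cayleyOp k n ^ s) p) := by
  induction s generalizing p with
  | zero => simp [fischer_one_left]
  | succ s ih =>
    rw [pow_succ', fischer_detX_mul, ih, pow_succ]
    rfl

theorem isHomogeneous_detX : (detX k n).IsHomogeneous n := by
  rw [detX, Matrix.det_apply']
  refine IsHomogeneous.sum _ _ _ fun σ _ => ?_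
  have h := IsHomogeneous.prod Finset.univ (fun i : Fin n => (X (σ i, i) : MatCoord k n))
    (fun _ => 1) fun i _ => isHomogeneous_X _ _
  have hc := isHomogeneous_C (Fin n × Fin n) ((Equiv.Perm.sign σ : ℤ) : k)
  simpa using hc.mul h

/-- Truncated subtraction is harmless: derivatives of constants are zero, and zero is homogeneous of
every degree. -/
theorem isHomogeneous_cayleyOp {p : MatCoord k n} {d : ℕ} (hp : p.IsHomogeneous d) :
    (cayleyOp k n p).IsHomogeneous (d - n) := by
  have hl (l : List (Fin n × Fin n)) :
      ((l.map fun a => ((pderiv a).toLinearMap : Module.End k (MatCoord k n))).prod p).IsHomogeneous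
        (d - l.length) := by
    induction l with
    | nil => simpa using hp
    | cons a l ih =>
      rw [List.map_cons, List.prod_cons, List.length_cons, ← Nat.sub_sub]
      exact ih.pderiv
  rw [cayleyOp, LinearMap.sum_apply]
  refine IsHomogeneous.sum _ _ _ fun σ _ => ?_
  have h := hl (List.ofFn fun i : Fin n => (σ i, i))
  rw [List.map_ofFn, List.length_ofFn] at h
  have hc := (isHomogeneous_C (Fin n × Fin n) ((Equiv.Perm.sign σ : ℤ) : k)).mul h
  rw [zero_add] at hc
  rw [LinearMap.smul_apply, smul_eq_C_mul]
  exact hc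

theorem isHomogeneous_cayleyOp_pow {p : MatCoord k n} (s : ℕ) (hp : p.IsHomogeneous (n * s)) :
    ((cayleyOp k n ^ s) p).IsHomogeneous 0 := by
  induction s generalizing p with
  | zero => simpa using hp
  | succ s ih =>
    rw [pow_succ]
    refine ih ?_
    simpa [mul_add] using isHomogeneous_cayleyOp hp

end CayleyAdjoint


theorem derivation_prod {R A : Type*} [CommRing R] [CommRing A] [Algebra R A]
    {ι : Type*} [DecidableEq ι] (D : Derivation R A A) (s : Finset ι) (f : ι → A) :
    D (∏ i ∈ s, f i) = ∑ i ∈ s, D (f i) * ∏ j ∈ s.erase i, f j := by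
  induction s using Finset.induction_on with
  | empty => simp
  | insert a s ha ih =>
    rw [Finset.prod_insert ha, D.leibniz, ih, Finset.sum_insert ha, Finset.erase_insert ha,
      smul_eq_mul, smul_eq_mul, Finset.mul_sum, add_comm, mul_comm]
    congr 1
    refine Finset.sum_congr rfl fun i hi => ?_
    have hia : a ≠ i := by rintro rfl; exact ha hi
    rw [Finset.erase_insert_of_ne hia, Finset.prod_insert (by simp [ha])]
    ring

/-! ### Partial derivatives on the group, through dual numbers. -/

section Deformation

variable (k : Type*) [Field k] {n : ℕ}

/-- The generic matrix with the `(i, j)` entry shifted by the dual number `ε`. -/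
def shiftMat (i j : Fin n) : Matrix (Fin n) (Fin n) (DualNumber (GLCoord k n)) :=
  ((genMat k n).map (TrivSqZeroExt.inlHom (GLCoord k n) (GLCoord k n))).updateRow i
    ((genMat k n).map (TrivSqZeroExt.inlHom (GLCoord k n) (GLCoord k n)) i +
      (DualNumber.eps : DualNumber (GLCoord k n)) • Pi.single j 1)

theorem shiftMat_apply (i j a b : Fin n) :
    shiftMat k i j a b = TrivSqZeroExt.inl (genMat k n a b) +
      if a = i ∧ b = j then DualNumber.eps else 0 := by
  by_cases ha : a = i
  · subst ha
    simp [shiftMat, Pi.single_apply]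
  · simp [shiftMat, ha]

/-- The determinant is linear in row `i`, so the coefficient of `ε` is a cofactor. -/
theorem det_shiftMat (i j : Fin n) :
    (shiftMat k i j).det = TrivSqZeroExt.inl (genMat k n).det +
      DualNumber.eps * TrivSqZeroExt.inl ((genMat k n).adjugate j i) := by
  have h : (genMat k n).map (TrivSqZeroExt.inlHom (GLCoord k n) (GLCoord k n)) =
    (TrivSqZeroExt.inlHom (GLCoord k n) (GLCoord k n)).mapMatrix (genMat k n) := rfl
  rw [shiftMat, Matrix.det_updateRow_add, Matrix.det_updateRow_smul, Matrix.updateRow_eq_self,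
    ← Matrix.adjugate_apply, h, ← RingHom.map_det, ← RingHom.map_adjugate]
  rfl

theorem isUnit_det_shiftMat (i j : Fin n) : IsUnit (shiftMat k i j).det := by
  rw [det_shiftMat, TrivSqZeroExt.isUnit_iff_isUnit_fst]
  simpa using isUnit_det_genMat k n

/-- The infinitesimal translation of the functions along the `(i, j)` coordinate. -/
def shiftGL (i j : Fin n) : GLCoord k n →ₐ[k] DualNumber (GLCoord k n) :=
  evalGL (shiftMat k i j) (isUnit_det_shiftMat k i j)

theorem shiftGL_genMat (i j a b : Fin n) :
    shiftGL k i j (genMat k n a b) = shiftMat k i j a b :=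
  congrFun (congrFun (map_genMat_evalGL (k := k) _ (isUnit_det_shiftMat k i j)) a) b

/-- Being the identity modulo `ε` is what makes the `ε`-part of `shiftGL` a derivation. -/
theorem fst_shiftGL (i j : Fin n) (a : GLCoord k n) : (shiftGL k i j a).fst = a := by
  have h : (TrivSqZeroExt.fstHom k (GLCoord k n) (GLCoord k n)).comp (shiftGL k i j) =
      AlgHom.id k _ := by
    apply algHom_ext_genMat
    ext a b
    simp only [Matrix.map_apply, AlgHom.comp_apply, shiftGL_genMat, shiftMat_apply]
    split_ifs <;> simp
  exact DFunLike.congr_fun h a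

/-- The partial derivative `∂/∂x_{ij}` on the functions of the general linear group. -/
def derivGL (i j : Fin n) : Derivation k (GLCoord k n) (GLCoord k n) :=
  Derivation.mk' ((TrivSqZeroExt.sndHom (GLCoord k n) (GLCoord k n)).restrictScalars k ∘ₗ
    (shiftGL k i j).toLinearMap) fun a b => by
      simp [fst_shiftGL, mul_comm]

theorem derivGL_apply (i j : Fin n) (a : GLCoord k n) :
    derivGL k i j a = (shiftGL k i j a).snd := rfl

theorem derivGL_genMat (i j a b : Fin n) :
    derivGL k i j (genMat k n a b) = if a = i ∧ b = j then 1 else 0 := by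
  rw [derivGL_apply, shiftGL_genMat, shiftMat_apply]
  split_ifs <;> simp

theorem algebraMap_detX : algebraMap (MatCoord k n) (GLCoord k n) (detX k n) = (genMat k n).det :=
  RingHom.map_det _ _

theorem derivGL_det (i j : Fin n) :
    derivGL k i j (genMat k n).det = (genMat k n).adjugate j i := by
  have h : shiftGL k i j (genMat k n).det = (shiftMat k i j).det := by
    rw [AlgHom.map_det]
    congr 1
    exact map_genMat_evalGL _ _
  rw [derivGL_apply, h, det_shiftMat]
  simp

theorem derivGL_algebraMap (i j : Fin n) (p : MatCoord k n) :
    derivGL k i j (algebraMap (MatCoord k n) (GLCoord k n) p) =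
      algebraMap (MatCoord k n) (GLCoord k n) (pderiv (i, j) p) := by
  induction p using MvPolynomial.induction_on with
  | C r =>
    rw [pderiv_C, map_zero]
    have h : algebraMap (MatCoord k n) (GLCoord k n) (C r) = algebraMap k (GLCoord k n) r :=
      (IsScalarTower.algebraMap_apply k (MatCoord k n) (GLCoord k n) r).symm
    rw [h, Derivation.map_algebraMap]
  | add p q hp hq => simp only [map_add, hp, hq]
  | mul_X p a hp =>
    have h : derivGL k i j (algebraMap (MatCoord k n) (GLCoord k n) (X a)) =
        if a.1 = i ∧ a.2 = j then 1 else 0 :=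
      derivGL_genMat k i j a.1 a.2
    have h' : pderiv (i, j) (X a : MatCoord k n) = if a.1 = i ∧ a.2 = j then 1 else 0 := by
      rw [pderiv_X, Pi.single_apply]
      simp only [Prod.ext_iff]
    rw [map_mul, Derivation.leibniz, hp, h, Derivation.leibniz, h', smul_eq_mul, smul_eq_mul,
      smul_eq_mul, smul_eq_mul, map_add, map_mul, map_mul]
    congr 2
    split_ifs
    · rw [map_one]
    · rw [map_zero]

/-- Differentiating `x * x⁻¹ = 1` gives `∂(x⁻¹) = -x⁻¹ (∂x) x⁻¹`, and `∂_{ij} x` is the matrix unit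
at `(i, j)`. -/
theorem derivGL_inv (i j a b : Fin n) :
    derivGL k i j ((genMat k n)⁻¹ a b) = - ((genMat k n)⁻¹ a i * (genMat k n)⁻¹ j b) := by
  set A := (genMat k n)⁻¹ with hA
  have hl := Matrix.nonsing_inv_mul _ (isUnit_det_genMat k n)
  have hr := Matrix.mul_nonsing_inv _ (isUnit_det_genMat k n)
  rw [← hA] at hl hr
  have h1 : (genMat k n).map (derivGL k i j) * A + genMat k n * A.map (derivGL k i j) = 0 := by
    ext c d
    have h := congrArg (derivGL k i j) (congrFun (congrFun hr c) d)
    have h0 : derivGL k i j ((1 : Matrix (Fin n) (Fin n) (GLCoord k n)) c d) = 0 := by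
      rw [Matrix.one_apply]; split_ifs <;> simp
    rw [h0, Matrix.mul_apply, map_sum] at h
    simp only [Derivation.leibniz, smul_eq_mul, Finset.sum_add_distrib] at h
    rw [Matrix.add_apply, Matrix.mul_apply, Matrix.mul_apply, Matrix.zero_apply, ← h, add_comm]
    simp only [Matrix.map_apply, mul_comm]
  have h2 : A.map (derivGL k i j) = - (A * ((genMat k n).map (derivGL k i j) * A)) := by
    rw [eq_neg_iff_add_eq_zero, add_comm]
    have h := congrArg (A * ·) h1
    simp only [Matrix.mul_add, ← Matrix.mul_assoc, hl, one_mul, Matrix.mul_zero] at h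
    simpa only [← Matrix.mul_assoc] using h
  have h3 := congrFun (congrFun h2 a) b
  rw [Matrix.map_apply] at h3
  rw [h3, Matrix.neg_apply, Matrix.mul_apply]
  congr 1
  rw [Finset.sum_eq_single_of_mem i (Finset.mem_univ _)]
  · congr 1
    rw [Matrix.mul_apply, Finset.sum_eq_single_of_mem j (Finset.mem_univ _)]
    · simp [derivGL_genMat]
    · intro c _ hc; simp [derivGL_genMat, hc]
  · intro c _ hc
    rw [Matrix.mul_apply, Finset.sum_eq_zero, mul_zero]
    intro d _
    simp [derivGL_genMat, hc]

theorem adjugate_genMat (i j : Fin n) :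
    (genMat k n).adjugate i j = (genMat k n).det * (genMat k n)⁻¹ i j := by
  rw [Matrix.inv_def, Matrix.smul_apply, smul_eq_mul, ← mul_assoc,
    Ring.mul_inverse_cancel _ (isUnit_det_genMat k n), one_mul]

theorem derivGL_det_pow (i j : Fin n) (s : ℕ) :
    derivGL k i j ((genMat k n).det ^ s) = s * (genMat k n).det ^ s * (genMat k n)⁻¹ j i := by
  rw [Derivation.leibniz_pow, derivGL_det, adjugate_genMat]
  cases s with
  | zero => simp
  | succ s => simp; ring

/-! ### Cayley's identity, one derivative at a time. -/

/-- The composite of the first `r` partial derivatives `∂/∂x_{σ(i), i}`. -/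
def partialCayley (r : ℕ) (σ : Equiv.Perm (Fin n)) : Module.End k (GLCoord k n) :=
  ((List.ofFn fun i : Fin n => (derivGL k (σ i) i).toLinearMap).take r).prod

theorem partialCayley_succ {r : ℕ} (hr : r < n) (σ : Equiv.Perm (Fin n)) (a : GLCoord k n) :
    partialCayley k (r + 1) σ a = partialCayley k r σ (derivGL k (σ ⟨r, hr⟩) ⟨r, hr⟩ a) := by
  rw [partialCayley, List.prod_take_succ _ _ (by simpa using hr), List.getElem_ofFn]
  rfl

theorem partialCayley_congr {r : ℕ} {σ τ : Equiv.Perm (Fin n)}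
    (h : ∀ i : Fin n, (i : ℕ) < r → σ i = τ i) : partialCayley k r σ = partialCayley k r τ := by
  unfold partialCayley
  congr 1
  apply List.ext_getElem
  · simp
  · intro i h1 h2
    simp only [List.length_take, List.length_ofFn, lt_min_iff] at h1
    simp [h ⟨i, h1.2⟩ h1.1]

/-- The signed sum interpolating between `D (det ^ s)` and `det ^ s * det (x⁻¹)`. -/
def cayleySum (n r s : ℕ) : GLCoord k n :=
  ∑ σ : Equiv.Perm (Fin n), ((Equiv.Perm.sign σ : ℤ) : k) •
    partialCayley k r σ ((genMat k n).det ^ s *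
      ∏ m ∈ ({m : Fin n | r ≤ (m : ℕ)} : Finset (Fin n)), (genMat k n)⁻¹ m (σ m))

/-- Reindexing by `σ ↦ σ * swap r m` exchanges the two column indices. The sign of the transposition
cancels the minus sign from `derivGL_inv`, and the first `r` derivatives do not change since the
swap fixes every `i < r`. -/
theorem cayleySum_swap {r : ℕ} (hr : r < n) (s : ℕ) (m : Fin n) (hm : r < (m : ℕ)) :
    ∑ σ : Equiv.Perm (Fin n), ((Equiv.Perm.sign σ : ℤ) : k) •
      partialCayley k r σ ((genMat k n).det ^ s *
        (-((genMat k n)⁻¹ m (σ ⟨r, hr⟩) * (genMat k n)⁻¹ ⟨r, hr⟩ (σ m)) *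
          ∏ l ∈ ({l : Fin n | r + 1 ≤ (l : ℕ)} : Finset (Fin n)).erase m,
            (genMat k n)⁻¹ l (σ l))) = cayleySum k n r s := by
  set ρ : Fin n := ⟨r, hr⟩ with hρ
  have hne : ρ ≠ m := by rintro rfl; exact lt_irrefl _ hm
  rw [cayleySum, ← Equiv.sum_comp (Equiv.mulRight (Equiv.swap ρ m))]
  refine Finset.sum_congr rfl fun σ _ => ?_
  rw [Equiv.coe_mulRight, Equiv.Perm.sign_mul, Equiv.Perm.sign_swap hne]
  have h1 : partialCayley k r (σ * Equiv.swap ρ m) = partialCayley k r σ := by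
    refine partialCayley_congr k fun i hi => ?_
    rw [Equiv.Perm.mul_apply, Equiv.swap_apply_of_ne_of_ne]
    · rintro rfl; exact lt_irrefl _ hi
    · rintro rfl; omega
  have h2 : ({l : Fin n | r ≤ (l : ℕ)} : Finset (Fin n)) =
      insert ρ (insert m (({l : Fin n | r + 1 ≤ (l : ℕ)} : Finset (Fin n)).erase m)) := by
    ext l
    simp only [Finset.mem_filter, Finset.mem_univ, true_and, Finset.mem_insert, Finset.mem_erase,
      Fin.ext_iff, hρ]
    omega
  rw [h1, h2, Finset.prod_insert (by
    rw [Finset.mem_insert, Finset.mem_erase, Finset.mem_filter]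
    rintro (h | ⟨-, -, h⟩)
    · exact hne h
    · simp [hρ] at h), Finset.prod_insert (by simp)]
  have h3 : ∏ l ∈ ({l : Fin n | r + 1 ≤ (l : ℕ)} : Finset (Fin n)).erase m,
      (genMat k n)⁻¹ l ((σ * Equiv.swap ρ m) l) =
      ∏ l ∈ ({l : Fin n | r + 1 ≤ (l : ℕ)} : Finset (Fin n)).erase m, (genMat k n)⁻¹ l (σ l) := by
    refine Finset.prod_congr rfl fun l hl => ?_
    rw [Equiv.Perm.mul_apply, Equiv.swap_apply_of_ne_of_ne]
    · rintro rfl; simp [hρ] at hl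
    · rintro rfl; simp at hl
  rw [h3, Equiv.Perm.mul_apply, Equiv.Perm.mul_apply, Equiv.swap_apply_left,
    Equiv.swap_apply_right]
  simp only [mul_neg, neg_mul, mul_one, Units.val_neg, Int.cast_neg, neg_smul, map_neg, smul_neg]
  rw [neg_neg, mul_comm ((genMat k n)⁻¹ m (σ m)), mul_assoc ((genMat k n)⁻¹ ρ (σ ρ))]

/-- By Leibniz, the innermost derivative contributes `s` from `det ^ s`, and `1` from each of the `n
- 1 - r` remaining entries of `x⁻¹`, by `cayleySum_swap`. -/
theorem cayleySum_succ {r : ℕ} (hr : r < n) (s : ℕ) :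
    cayleySum k n (r + 1) s = ((s + (n - 1 - r) : ℕ) : k) • cayleySum k n r s := by
  set ρ : Fin n := ⟨r, hr⟩ with hρ
  set F : Finset (Fin n) := {l : Fin n | r + 1 ≤ (l : ℕ)} with hF
  have hρF : ρ ∉ F := by simp [hF, hρ]
  have hcard : F.card = n - 1 - r := by
    have : F = Finset.Ioi ρ := by
      ext l; simp [hF, hρ, Fin.lt_def]
    rw [this, Fin.card_Ioi]
  have hins : ({l : Fin n | r ≤ (l : ℕ)} : Finset (Fin n)) = insert ρ F := by
    ext l
    simp only [hF, Finset.mem_filter, Finset.mem_univ, true_and, Finset.mem_insert,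
      Fin.ext_iff, hρ]
    omega
  have hsplit (σ : Equiv.Perm (Fin n)) :
      ((Equiv.Perm.sign σ : ℤ) : k) • partialCayley k (r + 1) σ ((genMat k n).det ^ s *
        ∏ m ∈ F, (genMat k n)⁻¹ m (σ m)) =
      (s : k) • (((Equiv.Perm.sign σ : ℤ) : k) • partialCayley k r σ ((genMat k n).det ^ s *
        ∏ m ∈ ({m : Fin n | r ≤ (m : ℕ)} : Finset (Fin n)), (genMat k n)⁻¹ m (σ m))) +
      ∑ m ∈ F, ((Equiv.Perm.sign σ : ℤ) : k) • partialCayley k r σ ((genMat k n).det ^ s *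
        (-((genMat k n)⁻¹ m (σ ρ) * (genMat k n)⁻¹ ρ (σ m)) *
          ∏ l ∈ F.erase m, (genMat k n)⁻¹ l (σ l))) := by
    have h : derivGL k (σ ρ) ρ ((genMat k n).det ^ s * ∏ m ∈ F, (genMat k n)⁻¹ m (σ m)) =
        (s : k) • ((genMat k n).det ^ s * ((genMat k n)⁻¹ ρ (σ ρ) *
          ∏ m ∈ F, (genMat k n)⁻¹ m (σ m))) +
        ∑ m ∈ F, (genMat k n).det ^ s *
          (-((genMat k n)⁻¹ m (σ ρ) * (genMat k n)⁻¹ ρ (σ m)) *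
            ∏ l ∈ F.erase m, (genMat k n)⁻¹ l (σ l)) := by
      rw [Derivation.leibniz, derivGL_det_pow, derivation_prod, smul_eq_mul, smul_eq_mul,
        Finset.mul_sum, add_comm, Nat.cast_smul_eq_nsmul, nsmul_eq_mul]
      congr 1
      · ring
      · refine Finset.sum_congr rfl fun m _ => ?_
        rw [derivGL_inv]
    rw [partialCayley_succ k hr, ← hρ, h, hins, Finset.prod_insert hρF, map_add, map_smul,
      map_sum, smul_add, Finset.smul_sum, smul_comm]
  rw [cayleySum, Finset.sum_congr rfl fun σ _ => hsplit σ, Finset.sum_add_distrib,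
    ← Finset.smul_sum, Finset.sum_comm, Finset.sum_congr rfl fun m hm => cayleySum_swap k hr s m
      (by simpa [hF, Nat.succ_le_iff] using hm), Finset.sum_const, hcard, ← Nat.cast_smul_eq_nsmul k,
    ← cayleySum, ← add_smul, Nat.cast_add]

theorem cayleySum_eq {r : ℕ} (hr : r ≤ n) (s : ℕ) :
    cayleySum k n r s =
      ((∏ i ∈ Finset.range r, (s + (n - 1 - i)) : ℕ) : k) • cayleySum k n 0 s := by
  induction r with
  | zero => simp
  | succ r ih =>
    rw [cayleySum_succ k hr, ih (Nat.le_of_succ_le hr), smul_smul, Finset.prod_range_succ,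
      Nat.cast_mul, mul_comm]

theorem cayleySum_zero (s : ℕ) :
    cayleySum k n 0 s = (genMat k n).det ^ s * (genMat k n)⁻¹.det := by
  rw [cayleySum, ← Matrix.det_transpose (genMat k n)⁻¹, Matrix.det_apply (genMat k n)⁻¹.transpose,
    Finset.mul_sum]
  refine Finset.sum_congr rfl fun σ _ => ?_
  rw [Units.smul_def, mul_smul_comm, Int.cast_smul_eq_zsmul]
  simp [partialCayley, Matrix.transpose_apply]

theorem algebraMap_cayleyOp (p : MatCoord k n) :
    algebraMap (MatCoord k n) (GLCoord k n) (cayleyOp k n p) =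
      ∑ σ : Equiv.Perm (Fin n), ((Equiv.Perm.sign σ : ℤ) : k) •
        partialCayley k n σ (algebraMap (MatCoord k n) (GLCoord k n) p) := by
  have hl (l : List (Fin n × Fin n)) :
      algebraMap (MatCoord k n) (GLCoord k n)
        ((l.map fun a => ((pderiv a).toLinearMap : Module.End k (MatCoord k n))).prod p) =
      (l.map fun a => ((derivGL k a.1 a.2).toLinearMap : Module.End k (GLCoord k n))).prod
        (algebraMap (MatCoord k n) (GLCoord k n) p) := by
    induction l with
    | nil => rfl
    | cons a l ih =>
      rw [List.map_cons, List.prod_cons, List.map_cons, List.prod_cons, Module.End.mul_apply,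
        Module.End.mul_apply, ← ih]
      exact (derivGL_algebraMap k a.1 a.2 _).symm
  rw [cayleyOp, LinearMap.sum_apply, map_sum]
  refine Finset.sum_congr rfl fun σ _ => ?_
  have h := hl (List.ofFn fun i : Fin n => (σ i, i))
  rw [List.map_ofFn, List.map_ofFn] at h
  have hs (c : k) (q : MatCoord k n) : algebraMap (MatCoord k n) (GLCoord k n) (c • q) =
      c • algebraMap (MatCoord k n) (GLCoord k n) q :=
    map_smul (IsScalarTower.toAlgHom k (MatCoord k n) (GLCoord k n)) c q
  rw [LinearMap.smul_apply, hs, partialCayley, List.take_of_length_le (by simp)]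
  exact congrArg _ h

theorem detX_ne_zero : detX k n ≠ 0 :=
  Matrix.det_mvPolynomialX_ne_zero (Fin n) k

/-- Lets polynomial identities be proved on the group, where `x⁻¹` is available. -/
theorem algebraMap_GLCoord_injective :
    Function.Injective (algebraMap (MatCoord k n) (GLCoord k n)) :=
  IsLocalization.injective (M := Submonoid.powers (detX k n)) _
    (powers_le_nonZeroDivisors_of_noZeroDivisors (detX_ne_zero k))

theorem mu_succ [CharZero k] (n s : ℕ) : mu k n (s + 1) = ((s + 1).ascFactorial n : k) := by
  have h : s + 1 + n - 1 = s + n := by omega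
  rw [mu, h, Nat.add_sub_cancel, ← Nat.factorial_mul_ascFactorial, Nat.cast_mul,
    mul_div_cancel_left₀ _ (Nat.cast_ne_zero.2 (Nat.factorial_ne_zero s))]

theorem mu_succ_ne_zero [CharZero k] (n s : ℕ) : mu k n (s + 1) ≠ 0 := by
  rw [mu_succ]
  exact Nat.cast_ne_zero.2 (Nat.ascFactorial_pos s n).ne'

/-- Cayley's identity. -/
theorem cayleyOp_detX_pow_succ [CharZero k] (s : ℕ) :
    cayleyOp k n (detX k n ^ (s + 1)) = mu k n (s + 1) • detX k n ^ s := by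
  apply algebraMap_GLCoord_injective k
  have hu : (genMat k n).det * (genMat k n)⁻¹.det = 1 := by
    rw [← Matrix.det_mul, Matrix.mul_nonsing_inv _ (isUnit_det_genMat k n), Matrix.det_one]
  have h0 : cayleySum k n n (s + 1) = algebraMap (MatCoord k n) (GLCoord k n)
      (cayleyOp k n (detX k n ^ (s + 1))) := by
    rw [algebraMap_cayleyOp, cayleySum]
    refine Finset.sum_congr rfl fun σ _ => ?_
    have hn : ({m : Fin n | n ≤ (m : ℕ)} : Finset (Fin n)) = ∅ := by
      ext m; simp
    rw [hn, Finset.prod_empty, mul_one, ← algebraMap_detX, ← map_pow (algebraMap _ _)]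
  have hs : algebraMap (MatCoord k n) (GLCoord k n) (mu k n (s + 1) • detX k n ^ s) =
      mu k n (s + 1) • algebraMap (MatCoord k n) (GLCoord k n) (detX k n ^ s) :=
    map_smul (IsScalarTower.toAlgHom k (MatCoord k n) (GLCoord k n)) _ _
  -- The factors `s + 1 + (n - 1 - i)` for `i < n`, read backwards, form the rising factorial `(s +
  -- 1) ⋯ (s + n)`.
  rw [← h0, cayleySum_eq k le_rfl, cayleySum_zero, pow_succ, mul_assoc, hu, mul_one, hs, map_pow,
    algebraMap_detX, mu_succ, Nat.ascFactorial_eq_prod_range,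
    Finset.prod_range_reflect (fun i => s + 1 + i) n]

theorem prod_mu_ne_zero [CharZero k] (n s : ℕ) : ∏ r ∈ Finset.Icc 1 s, mu k n r ≠ 0 := by
  refine Finset.prod_ne_zero_iff.2 fun r hr => ?_
  obtain ⟨t, rfl⟩ := Nat.exists_eq_add_of_le' (Finset.mem_Icc.1 hr).1
  exact mu_succ_ne_zero k n t

theorem cayleyOp_pow_detX_pow [CharZero k] (s : ℕ) :
    (cayleyOp k n ^ s) (detX k n ^ s) = C (∏ r ∈ Finset.Icc 1 s, mu k n r) := by
  induction s with
  | zero => simp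
  | succ s ih =>
    rw [pow_succ (cayleyOp k n), Module.End.mul_apply, cayleyOp_detX_pow_succ, map_smul, ih,
      Finset.prod_Icc_succ_top (Nat.le_add_left 1 s), smul_eq_C_mul, ← C_mul, mul_comm]

end Deformation

/-! ### Uniqueness, construction and invariance of the integral. -/

section Integral

variable (k : Type*) [Field k] {n : ℕ}

/-- Fubini: `(w ⊗ v) (Δ a)` equals `w a` by left invariance of `w` and `v a` by right invariance of
`v`. -/
theorem IsInvariantIntegral.unique {A : Type*} [CommRing A] [HopfAlgebra k A]
    {w v : A →ₗ[k] k} (hw : IsInvariantIntegral k w) (hv : IsInvariantIntegral k v) : w = v := by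
  ext a
  have h1 : v (TensorProduct.lid k A (w.rTensor A (Coalgebra.comul (R := k) a))) =
      w (TensorProduct.rid k A (v.lTensor A (Coalgebra.comul (R := k) a))) := by
    induction Coalgebra.comul (R := k) a using TensorProduct.induction_on with
    | zero => simp
    | tmul x y => simp [mul_comm]
    | add x y hx hy => simp only [map_add, hx, hy]
  rw [hw.left_inv, hv.right_inv, Algebra.algebraMap_eq_smul_one, Algebra.algebraMap_eq_smul_one,
    map_smul, map_smul, hw.map_one, hv.map_one] at h1
  simpa using h1

theorem divDetPow_mul_det_pow (p : MatCoord k n) (s : ℕ) :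
    divDetPow p s * (genMat k n).det ^ s = algebraMap (MatCoord k n) (GLCoord k n) p := by
  rw [divDetPow, Localization.mk_eq_mk', ← algebraMap_detX, ← map_pow]
  exact IsLocalization.mk'_spec _ p (⟨detX k n ^ s, s, rfl⟩ : Submonoid.powers (detX k n))

theorem eq_divDetPow {a : GLCoord k n} {p : MatCoord k n} {s : ℕ}
    (h : a * (genMat k n).det ^ s = algebraMap (MatCoord k n) (GLCoord k n) p) :
    a = divDetPow p s := by
  refine ((isUnit_det_genMat k n).pow s).mul_right_cancel ?_
  rw [h, divDetPow_mul_det_pow]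

theorem exists_eq_divDetPow (a : GLCoord k n) : ∃ p s, a = divDetPow (k := k) (n := n) p s := by
  obtain ⟨⟨p, ⟨_, s, rfl⟩⟩, rfl⟩ := Localization.mkHom_surjective a
  exact ⟨p, s, rfl⟩

theorem divDetPow_eq_mul (p : MatCoord k n) (s : ℕ) :
    divDetPow p s = algebraMap (MatCoord k n) (GLCoord k n) p * divDetPow 1 s := by
  refine (eq_divDetPow k ?_).symm
  rw [mul_assoc, divDetPow_mul_det_pow, map_one, mul_one]

/-- The value of the invariant integral at `p / det ^ s`. -/
def integralValue (p : MatCoord k n) (s : ℕ) : k :=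
  fischer _ k (detX k n ^ s) p / ∏ r ∈ Finset.Icc 1 s, mu k n r

/-- Independence of the representing fraction: each extra `det` crosses the pairing as `D`, and
Cayley's identity yields the `μ` that the denominator gained. -/
theorem integralValue_mul_detX_pow [CharZero k] (p : MatCoord k n) (s t : ℕ) :
    integralValue k (p * detX k n ^ t) (s + t) = integralValue k p s := by
  induction t with
  | zero => simp
  | succ t ih =>
    rw [← ih, ← add_assoc, integralValue, integralValue, pow_succ (detX k n) t, ← mul_assoc,
      mul_comm _ (detX k n), fischer_symm, fischer_detX_mul, cayleyOp_detX_pow_succ, map_smul,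
      Finset.prod_Icc_succ_top (Nat.le_add_left 1 _), smul_eq_mul, fischer_symm,
      mul_comm (mu k n _), mul_div_mul_right _ _ (mu_succ_ne_zero k n _)]

theorem integralValue_congr [CharZero k] {p q : MatCoord k n} {s t : ℕ}
    (h : divDetPow p s = divDetPow q t) : integralValue k p s = integralValue k q t := by
  have h' : p * detX k n ^ t = q * detX k n ^ s := by
    apply algebraMap_GLCoord_injective k
    rw [map_mul, map_mul, ← divDetPow_mul_det_pow k p s, ← divDetPow_mul_det_pow k q t, h, map_pow,
      map_pow, algebraMap_detX]
    ring
  rw [← integralValue_mul_detX_pow k p s t, h', add_comm s t, integralValue_mul_detX_pow]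

theorem integralValue_add (p q : MatCoord k n) (s : ℕ) :
    integralValue k (p + q) s = integralValue k p s + integralValue k q s := by
  rw [integralValue, map_add, add_div]; rfl

theorem integralValue_smul (c : k) (p : MatCoord k n) (s : ℕ) :
    integralValue k (c • p) s = c * integralValue k p s := by
  rw [integralValue, map_smul, smul_eq_mul, mul_div_assoc]; rfl

theorem exists_integral [CharZero k] : ∃ w : GLCoord k n →ₗ[k] k,
    ∀ (p : MatCoord k n) (s : ℕ), w (divDetPow p s) = integralValue k p s := by
  -- Arbitrary representatives suffice, since `integralValue_congr` makes the choice immaterial.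
  choose p s hps using exists_eq_divDetPow k (n := n)
  refine ⟨{ toFun := fun a => integralValue k (p a) (s a), map_add' := ?_, map_smul' := ?_ }, ?_⟩
  · intro a b
    have h : a + b = divDetPow (p a * detX k n ^ s b + p b * detX k n ^ s a) (s a + s b) := by
      apply eq_divDetPow
      rw [map_add, map_mul, map_mul, ← divDetPow_mul_det_pow k (p a) (s a),
        ← divDetPow_mul_det_pow k (p b) (s b), ← hps, ← hps, map_pow, map_pow, algebraMap_detX]
      ring
    rw [integralValue_congr k ((hps (a + b)).symm.trans h), integralValue_add,
      integralValue_mul_detX_pow, add_comm (s a), integralValue_mul_detX_pow]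
  · intro c a
    have h : c • a = divDetPow (c • p a) (s a) := by
      apply eq_divDetPow
      rw [smul_mul_assoc, Algebra.algebraMap_eq_smul_one (A := GLCoord k n), smul_assoc,
        ← Algebra.algebraMap_eq_smul_one, ← divDetPow_mul_det_pow k (p a) (s a), ← hps]
    rw [integralValue_congr k ((hps (c • a)).symm.trans h), integralValue_smul]
    rfl
  · intro q t
    exact integralValue_congr k (hps _).symm

/-- Integration along the second factor of a product of two groups. -/
def integrateSnd {A : Type*} [CommRing A] [Algebra k A] (w : A →ₗ[k] k) : A ⊗[k] A →ₗ[k] A :=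
  (TensorProduct.rid k A).toLinearMap ∘ₗ w.lTensor A

theorem integrateSnd_tmul {A : Type*} [CommRing A] [Algebra k A] (w : A →ₗ[k] k) (x y : A) :
    integrateSnd k w (x ⊗ₜ y) = w y • x := by
  simp [integrateSnd]

theorem integrateSnd_mul {A : Type*} [CommRing A] [Algebra k A] (w : A →ₗ[k] k) (x : A)
    (z : A ⊗[k] A) : integrateSnd k w (x ⊗ₜ 1 * z) = x * integrateSnd k w z := by
  induction z using TensorProduct.induction_on with
  | zero => simp
  | tmul a b => simp [integrateSnd_tmul]
  | add a b ha hb => simp only [mul_add, map_add, ha, hb]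

variable (n) in
/-- Polynomial functions of the second matrix, with coefficients functions of the first one. -/
def polySnd : MvPolynomial (Fin n × Fin n) (GLCoord k n) →ₐ[GLCoord k n]
    GLCoord k n ⊗[k] GLCoord k n :=
  aeval fun a => 1 ⊗ₜ genMat k n a.1 a.2

theorem polySnd_map (p : MatCoord k n) :
    polySnd k n (map (algebraMap k (GLCoord k n)) p) =
      1 ⊗ₜ algebraMap (MatCoord k n) (GLCoord k n) p := by
  induction p using MvPolynomial.induction_on with
  | C r =>
    have h : algebraMap (MatCoord k n) (GLCoord k n) (C r) = algebraMap k (GLCoord k n) r :=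
      (IsScalarTower.algebraMap_apply k (MatCoord k n) (GLCoord k n) r).symm
    rw [map_C, h, polySnd, aeval_C, Algebra.TensorProduct.algebraMap_apply,
      Algebra.algebraMap_self_apply, Algebra.algebraMap_eq_smul_one, TensorProduct.smul_tmul]
  | add p q hp hq => simp only [map_add, hp, hq, TensorProduct.tmul_add]
  | mul_X p a hp =>
    rw [map_mul, map_mul, hp, map_mul, map_X, polySnd, aeval_X,
      Algebra.TensorProduct.tmul_mul_tmul, one_mul]
    rfl

/-- Both sides are linear in `f` over `GLCoord k n`, so the formula reduces to monomials with
coefficient `1`, where it is the formula for `w`. -/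
theorem integrateSnd_polySnd {w : GLCoord k n →ₗ[k] k}
    (hw : ∀ (p : MatCoord k n) (s : ℕ), w (divDetPow p s) = integralValue k p s) (s : ℕ)
    (f : MvPolynomial (Fin n × Fin n) (GLCoord k n)) :
    integrateSnd k w (polySnd k n f * 1 ⊗ₜ divDetPow 1 s) =
      (∏ r ∈ Finset.Icc 1 s, mu k n r)⁻¹ •
        fischer _ (GLCoord k n) (map (algebraMap k (GLCoord k n)) (detX k n ^ s)) f := by
  induction f using MvPolynomial.induction_on' with
  | add p q hp hq => simp only [map_add, add_mul, hp, hq, smul_add]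
  | monomial α c =>
    have h : monomial α c = C c * map (algebraMap k (GLCoord k n)) (monomial α (1 : k)) := by
      rw [map_monomial, map_one, C_mul_monomial, mul_one]
    have hc : polySnd k n (C c) = c ⊗ₜ 1 := by
      rw [polySnd, aeval_C, Algebra.TensorProduct.algebraMap_apply, Algebra.algebraMap_self_apply]
    rw [h, map_mul (polySnd k n), hc, polySnd_map, ← smul_eq_C_mul, map_smul, mul_assoc, integrateSnd_mul,
      Algebra.TensorProduct.tmul_mul_tmul, one_mul, ← divDetPow_eq_mul, integrateSnd_tmul, hw,
      map_fischer, integralValue, div_eq_inv_mul, Algebra.algebraMap_eq_smul_one, mul_smul,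
      smul_eq_mul, mul_smul_comm]

/-- Invariance of the integral under a translation `δ` which is linear in the coordinates. -/
theorem integrateSnd_translate {w : GLCoord k n →ₗ[k] k}
    (hw : ∀ (p : MatCoord k n) (s : ℕ), w (divDetPow p s) = integralValue k p s)
    (N : Fin n × Fin n → Fin n × Fin n → GLCoord k n)
    (hN : aeval (fun b => ∑ a, C (N a b) * X a)
        (map (algebraMap k (GLCoord k n)) (detX k n)) =
      C (genMat k n).det * map (algebraMap k (GLCoord k n)) (detX k n))
    (δ : GLCoord k n →ₐ[k] GLCoord k n ⊗[k] GLCoord k n)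
    (hδ : ∀ a, δ (genMat k n a.1 a.2) = ∑ b, N a b ⊗ₜ genMat k n b.1 b.2)
    (hdet : δ (genMat k n).det = (genMat k n).det ⊗ₜ (genMat k n).det) (a : GLCoord k n) :
    integrateSnd k w (δ a) = algebraMap k (GLCoord k n) (w a) := by
  obtain ⟨p, s, rfl⟩ := exists_eq_divDetPow k a
  have hp (p : MatCoord k n) : δ (algebraMap (MatCoord k n) (GLCoord k n) p) =
      polySnd k n (aeval (fun a => ∑ b, C (N a b) * X b)
        (map (algebraMap k (GLCoord k n)) p)) := by
    induction p using MvPolynomial.induction_on with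
    | C r =>
      have h : algebraMap (MatCoord k n) (GLCoord k n) (C r) = algebraMap k (GLCoord k n) r :=
        (IsScalarTower.algebraMap_apply k (MatCoord k n) (GLCoord k n) r).symm
      rw [map_C, h, aeval_C, AlgHom.commutes, AlgHom.commutes,
        Algebra.TensorProduct.algebraMap_apply, Algebra.TensorProduct.algebraMap_apply,
        Algebra.algebraMap_self_apply]
    | add p q hp hq => simp only [map_add, hp, hq]
    | mul_X p a hp =>
      have h : δ (algebraMap (MatCoord k n) (GLCoord k n) (X a)) =
        ∑ b, N a b ⊗ₜ genMat k n b.1 b.2 := hδ a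
      rw [map_mul, map_mul, hp, h, map_mul, map_mul, map_mul, map_X, aeval_X, map_sum]
      congr 1
      refine Finset.sum_congr rfl fun b _ => ?_
      rw [map_mul, polySnd, aeval_C, aeval_X, Algebra.TensorProduct.algebraMap_apply,
        Algebra.algebraMap_self_apply, Algebra.TensorProduct.tmul_mul_tmul, one_mul, mul_one]
  -- Since `δ` sends `det` to `det ⊗ det`, clearing the denominator of the first factor leaves a
  -- polynomial in the second matrix over `det ^ s`.
  have h1 : ((genMat k n).det ^ s) ⊗ₜ 1 * δ (divDetPow p s) =
      δ (algebraMap (MatCoord k n) (GLCoord k n) p) * 1 ⊗ₜ[k] divDetPow 1 s := by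
    rw [← divDetPow_mul_det_pow k p s, map_mul, map_pow, hdet, Algebra.TensorProduct.tmul_pow,
      mul_assoc, Algebra.TensorProduct.tmul_mul_tmul, mul_one, mul_comm (_ ^ s) (divDetPow 1 s),
      divDetPow_mul_det_pow, map_one, mul_comm]
  refine ((isUnit_det_genMat k n).pow s).mul_left_cancel ?_
  -- The substitution passes, transposed, to `det ^ s`; by `hN` it only multiplies it by `(genMat k
  -- n).det ^ s`, the factor introduced to clear the denominator.
  rw [← integrateSnd_mul, h1, hp, integrateSnd_polySnd k hw, fischer_aeval_linear, map_pow,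
    map_pow, hN, mul_pow, ← C_pow, ← smul_eq_C_mul, map_smul, LinearMap.smul_apply, ← map_pow,
    map_fischer, hw, integralValue, div_eq_inv_mul, Algebra.algebraMap_eq_smul_one,
    Algebra.algebraMap_eq_smul_one, mul_smul, smul_eq_mul, mul_smul_comm, mul_smul_comm,
    mul_smul_comm]

theorem map_detX {R : Type*} [CommRing R] [Algebra k R] :
    map (algebraMap k R) (detX k n) = (Matrix.mvPolynomialX (Fin n) (Fin n) R).det := by
  rw [detX, RingHom.map_det]
  congr 1
  ext i j
  simp

theorem comulGL_det :
    comulGL k n (genMat k n).det = (genMat k n).det ⊗ₜ (genMat k n).det := by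
  have h : comulGL k n (genMat k n).det = (mulMat k n).det := by
    rw [AlgHom.map_det]
    congr 1
    exact map_genMat_evalGL _ _
  have h1 (f : GLCoord k n →ₐ[k] GLCoord k n ⊗[k] GLCoord k n) :
      ((genMat k n).map f).det = f (genMat k n).det := (AlgHom.map_det f _).symm
  rw [h, mulMat, Matrix.det_mul, h1, h1]
  simp

theorem isInvariantIntegral_of_integralValue {w : GLCoord k n →ₗ[k] k}
    (hw : ∀ (p : MatCoord k n) (s : ℕ), w (divDetPow p s) = integralValue k p s) :
    IsInvariantIntegral k w where
  map_one := by
    have h : (1 : GLCoord k n) = divDetPow 1 0 := eq_divDetPow k (by simp)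
    rw [h, hw, integralValue, pow_zero, fischer_one_left]
    simp
  left_inv a := by
    have hc (z : GLCoord k n ⊗[k] GLCoord k n) :
        TensorProduct.lid k _ (w.rTensor _ z) =
          integrateSnd k w (Algebra.TensorProduct.comm k _ _ z) := by
      induction z using TensorProduct.induction_on with
      | zero => simp
      | tmul x y => simp [integrateSnd_tmul]
      | add x y hx hy => simp only [map_add, hx, hy]
    refine (hc _).trans ?_
    -- After exchanging the tensor factors, `x_{ij}` goes to `∑ l, x_{lj} ⊗ x_{il}`. The transposed
    -- substitution is right multiplication of the generic matrix by `xᵀ`.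
    refine integrateSnd_translate k hw (fun a b => if b.1 = a.1 then genMat k n b.2 a.2 else 0) ?_
      ((Algebra.TensorProduct.comm k _ _).toAlgHom.comp (comulGL k n)) ?_ ?_ a
    · rw [map_detX, AlgHom.map_det]
      have h : (aeval fun b : Fin n × Fin n => ∑ a : Fin n × Fin n,
          C (if b.1 = a.1 then genMat k n b.2 a.2 else 0) * X a).mapMatrix
            (Matrix.mvPolynomialX (Fin n) (Fin n) (GLCoord k n)) =
          Matrix.mvPolynomialX (Fin n) (Fin n) (GLCoord k n) * C.mapMatrix (genMat k n).transpose := by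
        ext1 i j
        simp [Matrix.mul_apply, Fintype.sum_prod_type, apply_ite C, mul_comm]
      rw [h, Matrix.det_mul, ← RingHom.map_det, Matrix.det_transpose, mul_comm]
    · rintro ⟨i, j⟩
      rw [AlgHom.comp_apply, comulGL_genMat, map_sum, Fintype.sum_prod_type]
      simp [TensorProduct.ite_tmul]
    · rw [AlgHom.comp_apply, comulGL_det]
      rfl
  right_inv a := by
    -- Here the transposed substitution is left multiplication by `xᵀ`.
    refine integrateSnd_translate k hw (fun a b => if a.2 = b.2 then genMat k n a.1 b.1 else 0) ?_
      (comulGL k n) ?_ (comulGL_det k) a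
    · rw [map_detX, AlgHom.map_det]
      have h : (aeval fun b : Fin n × Fin n => ∑ a : Fin n × Fin n,
          C (if a.2 = b.2 then genMat k n a.1 b.1 else 0) * X a).mapMatrix
            (Matrix.mvPolynomialX (Fin n) (Fin n) (GLCoord k n)) =
          C.mapMatrix (genMat k n).transpose * Matrix.mvPolynomialX (Fin n) (Fin n) (GLCoord k n) := by
        ext1 i j
        simp [Matrix.mul_apply, Fintype.sum_prod_type, apply_ite C, ite_mul]
      rw [h, Matrix.det_mul, ← RingHom.map_det, Matrix.det_transpose]
    · rintro ⟨i, j⟩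
      rw [comulGL_genMat, Fintype.sum_prod_type]
      simp [TensorProduct.ite_tmul]

theorem integralValue_eq [CharZero k] (p : MatCoord k n) (s : ℕ) :
    integralValue k p s =
      constantCoeff ((cayleyOp k n ^ s) (homogeneousComponent (n * s) p)) /
        constantCoeff ((cayleyOp k n ^ s) (detX k n ^ s)) := by
  rw [cayleyOp_pow_detX_pow, constantCoeff_C, ← fischer_detX_pow, integralValue,
    fischer_homogeneousComponent]
  exact isHomogeneous_detX.pow s

end Integral

end GLIntegral

end

open GLIntegral in
theorem mainTheorem3 (k : Type*) [Field k] [CharZero k] (n : ℕ) :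
    (∃! w : GLCoord k n →ₗ[k] k, IsInvariantIntegral k w) ∧
    (∀ w : GLCoord k n →ₗ[k] k, IsInvariantIntegral k w →
      ∀ (p : MatCoord k n) (s : ℕ),
        w (divDetPow p s) =
          MvPolynomial.constantCoeff
              ((cayleyOp k n ^ s) (MvPolynomial.homogeneousComponent (n * s) p)) /
            MvPolynomial.constantCoeff ((cayleyOp k n ^ s) (detX k n ^ s))) ∧
    (∀ (p : MatCoord k n) (s : ℕ),
      ∃ c : k, (cayleyOp k n ^ s) (MvPolynomial.homogeneousComponent (n * s) p) =
        MvPolynomial.C c) ∧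
    (∀ s : ℕ,
      (cayleyOp k n ^ s) (detX k n ^ s) = MvPolynomial.C (∏ r ∈ Finset.Icc 1 s, mu k n r) ∧
        ∏ r ∈ Finset.Icc 1 s, mu k n r ≠ 0) := by
  obtain ⟨w, hw⟩ := exists_integral k (n := n)
  have hinv := isInvariantIntegral_of_integralValue k hw
  refine ⟨⟨w, hinv, fun v hv => hv.unique k hinv⟩, fun v hv p s => ?_, fun p s => ?_, fun s => ?_⟩
  · rw [hv.unique k hinv, hw, integralValue_eq]
  · have h := isHomogeneous_cayleyOp_pow s (homogeneousComponent_isHomogeneous (n * s) p)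
    exact ⟨_, totalDegree_eq_zero_iff_eq_C.1 ((totalDegree_zero_iff_isHomogeneous _).2 h)⟩
  · exact ⟨cayleyOp_pow_detX_pow k s, prod_mu_ne_zero k n s⟩
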